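/- Let $R$ be a Cohen–Macaulay local ring, that is, a commutative Noetherian local ring whose depth equals its Krull dimension. A finitely generated $R$-module $G$ is called totally reflexive (of G-dimension $0$) if the canonical map $G \to G^{**}$, where $(-)^* = \operatorname{Hom}_R(-,R)$, is an isomorphism and $\operatorname{Ext}^i_R(G,R) = 0 = \operatorname{Ext}^i_R(G^*,R)$ for all $i > 0$. A finitely generated $R$-module $N$ has finite G-dimension, written $\operatorname{G-dim}_R N < \infty$, if for some $n \ge 0$ there is an exact sequence $0 \to G_n \to \cdots \to G_0 \to N \to 0$ with all $G_j$ totally reflexive. Let $M$ be a finitely generated $R$-module that is a G-dim-test module: for every finitely generated $R$-module $N$, if $\operatorname{Tor}_i^R(M,N) = 0$ for all $i \gg 0$, then $\operatorname{G-dim}_R N < \infty$. If $\operatorname{Ext}^i_R(M,R) = 0$ for all $i \gg 0$, then $R$ is Gorenstein, that is, $R$ has finite injective dimension as a module over itself. -/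

import Mathlib

open CategoryTheory

universe u

/-- The depth of a local ring: the supremum of the lengths of the regular sequences on `R`
whose entries lie in the maximal ideal. -/
noncomputable def localRingDepth (R : Type u) [CommRing R] [IsLocalRing R] : ℕ∞ :=
  ⨆ (rs : List R) (_ : RingTheory.Sequence.IsRegular R rs ∧
    ∀ r ∈ rs, r ∈ IsLocalRing.maximalIdeal R), (rs.length : ℕ∞)

/-- A Cohen-Macaulay local ring: a Noetherian local ring whose depth equals its Krull dimension. -/
structure IsCohenMacaulayLocal (R : Type u) [CommRing R] [IsLocalRing R] : Prop where
  isNoetherianRing : IsNoetherianRing R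
  depth_eq_dim : ((localRingDepth R : ℕ∞) : WithBot ℕ∞) = ringKrullDim R

/-- A Gorenstein local ring: a Noetherian local ring that has finite injective dimension as a
module over itself. -/
structure IsGorensteinLocal (R : Type u) [CommRing R] [IsLocalRing R] : Prop where
  isNoetherianRing : IsNoetherianRing R
  injectiveDimension_lt_top : injectiveDimension (ModuleCat.of R R) < ⊤

/-- `Ext^i_R(M, N) = 0`. -/
def ExtVanishes (R : Type u) [CommRing R] (M N : Type u) [AddCommGroup M] [Module R M]
    [AddCommGroup N] [Module R N] (i : ℕ) : Prop :=
  Subsingleton (Abelian.Ext (ModuleCat.of R M) (ModuleCat.of R N) i)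

/-- `Tor_i^R(M, N) = 0`. -/
def TorVanishes (R : Type u) [CommRing R] (M N : Type u) [AddCommGroup M] [Module R M]
    [AddCommGroup N] [Module R N] (i : ℕ) : Prop :=
  Limits.IsZero (((Tor (ModuleCat.{u} R) i).obj (ModuleCat.of R M)).obj (ModuleCat.of R N))

/-- Modules of G-dimension zero in the sense of Auslander and Bridger (totally reflexive modules):
`G` is finitely generated, the biduality map `G → G**` is an isomorphism, and
`Ext^i(G, R) = 0 = Ext^i(G*, R)` for all `i > 0`, where `G* = Hom_R(G, R)`. -/
structure IsTotallyReflexive (R : Type u) [CommRing R] (G : Type u) [AddCommGroup G]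
    [Module R G] : Prop where
  finite : Module.Finite R G
  bijective_eval : Function.Bijective (Module.Dual.eval R G)
  ext_vanishes : ∀ i : ℕ, 0 < i → ExtVanishes R G R i
  ext_dual_vanishes : ∀ i : ℕ, 0 < i → ExtVanishes R (Module.Dual R G) R i

/-- `G-dim_R N ≤ n`: there is an exact sequence `0 → G_n → ⋯ → G_1 → G_0 → N → 0` in which every
`G_j` is totally reflexive. The sequence is built from the right, one syzygy at a time: for
`n = 0` the module `N` is itself totally reflexive, and for `n + 1` there is a surjection
`G_0 → N` whose kernel has such a resolution of length `n`. -/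
def GDimLE (R : Type u) [CommRing R] :
    ℕ → ∀ (N : Type u) [AddCommGroup N] [Module R N], Prop
  | 0, N, _, _ => IsTotallyReflexive R N
  | n + 1, N, _, _ =>
      ∃ (G : Type u) (_ : AddCommGroup G) (_ : Module R G) (f : G →ₗ[R] N),
        IsTotallyReflexive R G ∧ Function.Surjective f ∧ GDimLE R n (LinearMap.ker f)

/-- `G-dim_R N < ∞`. -/
def HasFiniteGDim (R : Type u) [CommRing R] (N : Type u) [AddCommGroup N] [Module R N] : Prop :=
  ∃ n : ℕ, GDimLE R n N

/-- `M` is a G-dim-test module: every finitely generated `R`-module `N` with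
`Tor_i^R(M, N) = 0` for all `i ≫ 0` has finite G-dimension. -/
def IsGDimTestModule (R : Type u) [CommRing R] (M : Type u) [AddCommGroup M] [Module R M] :
    Prop :=
  ∀ (N : Type u) [AddCommGroup N] [Module R N] [Module.Finite R N],
    (∃ n : ℕ, ∀ i : ℕ, n ≤ i → TorVanishes R M N i) → HasFiniteGDim R N

/-! ### Long exact sequences for vanishing of Ext. -/

section ExtSequences

open Abelian

variable {R : Type u} [CommRing R]
  {A B C N : Type u} [AddCommGroup A] [Module R A] [AddCommGroup B] [Module R B]
  [AddCommGroup C] [Module R C] [AddCommGroup N] [Module R N]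

/-! Let `B` be the quotient of `R` by a regular sequence of length `dim R`, let `E` be an injective
module with simple socle, and let `X = Hom(B, E)`. Since `B` has finite length and finite projective
dimension, `X` has finite length and finite injective dimension.

Vanishing of `Ext(M, R)` in high degrees passes to `Ext(M, B)`, and dualizing into `E` turns it into
vanishing of `Tor(M, X)` (`ExtVanishes.torVanishes`). The test property then gives `X` finite
G-dimension, so `X` embeds in some `P` of finite projective dimension with totally reflexive
cokernel `C` (`GDimLE.exists_hull`). As `X` has finite injective dimension, `Ext^1(C, X) = 0`
(`IsTotallyReflexive.extVanishes_of_hasInjectiveDimensionLT`), so `X` is a direct summand of `P`.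

Dualizing once more, `B ≅ Hom(X, E)` (`bijective_applyₗ`) is a summand of `Hom(P, E)`, which has
finite injective dimension. By Nakayama, finiteness lifts from `B` to `R`
(`hasInjectiveDimensionLT_of_quotient_isWeaklyRegular`). -/

/-- The short complex of modules attached to an exact pair of linear maps. -/
abbrev moduleShortComplex (f : A →ₗ[R] B) (g : B →ₗ[R] C) (h : Function.Exact f g) :
    ShortComplex (ModuleCat.{u} R) :=
  ModuleCat.shortComplexOfCompEqZero f g h.linearMap_comp_eq_zero

lemma moduleShortComplex_shortExact {f : A →ₗ[R] B} {g : B →ₗ[R] C}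
    (hf : Function.Injective f) (h : Function.Exact f g) (hg : Function.Surjective g) :
    (moduleShortComplex f g h).ShortExact :=
  ModuleCat.shortComplex_shortExact _ h hf hg

lemma ExtVanishes.of_exact_middle {f : A →ₗ[R] B} {g : B →ₗ[R] C}
    (hf : Function.Injective f) (h : Function.Exact f g) (hg : Function.Surjective g)
    {i : ℕ} (hA : ExtVanishes R A N i) (hC : ExtVanishes R C N i) : ExtVanishes R B N i := by
  have hS := moduleShortComplex_shortExact hf h hg
  unfold ExtVanishes at *
  refine subsingleton_of_forall_eq 0 fun x ↦ ?_
  obtain ⟨y, rfl⟩ := Ext.contravariant_sequence_exact₂ hS (ModuleCat.of R N) x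
    (hA.elim _ _)
  rw [show y = 0 from hC.elim _ _, Ext.comp_zero]

lemma ExtVanishes.of_exact_right {f : A →ₗ[R] B} {g : B →ₗ[R] C}
    (hf : Function.Injective f) (h : Function.Exact f g) (hg : Function.Surjective g)
    {i : ℕ} (hA : ExtVanishes R A N i) (hB : ExtVanishes R B N (i + 1)) :
    ExtVanishes R C N (i + 1) := by
  have hS := moduleShortComplex_shortExact hf h hg
  unfold ExtVanishes at *
  refine subsingleton_of_forall_eq 0 fun x ↦ ?_
  obtain ⟨y, rfl⟩ := Ext.contravariant_sequence_exact₃ hS (ModuleCat.of R N) x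
    (hB.elim _ _) (add_comm 1 i)
  rw [show y = 0 from hA.elim _ _, Ext.comp_zero]

lemma ExtVanishes.of_exact_left {f : A →ₗ[R] B} {g : B →ₗ[R] C}
    (hf : Function.Injective f) (h : Function.Exact f g) (hg : Function.Surjective g)
    {i : ℕ} (hB : ExtVanishes R B N i) (hC : ExtVanishes R C N (i + 1)) :
    ExtVanishes R A N i := by
  have hS := moduleShortComplex_shortExact hf h hg
  unfold ExtVanishes at *
  refine subsingleton_of_forall_eq 0 fun x ↦ ?_
  obtain ⟨y, rfl⟩ := Ext.contravariant_sequence_exact₁ hS (ModuleCat.of R N) x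
    (add_comm 1 i) (hC.elim _ _)
  rw [show y = 0 from hB.elim _ _, Ext.comp_zero]

/-- If `Ext^1(C, N) = 0`, then linear maps to `N` extend along `0 → A → B → C → 0`. -/
lemma ExtVanishes.exists_extension {f : A →ₗ[R] B} {g : B →ₗ[R] C}
    (hf : Function.Injective f) (h : Function.Exact f g) (hg : Function.Surjective g)
    (hC : ExtVanishes R C N 1) (φ : A →ₗ[R] N) : ∃ ψ : B →ₗ[R] N, ψ ∘ₗ f = φ := by
  have hS := moduleShortComplex_shortExact hf h hg
  unfold ExtVanishes at *
  obtain ⟨y, hy⟩ := Ext.contravariant_sequence_exact₁ hS (ModuleCat.of R N)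
    (Ext.mk₀ (ModuleCat.ofHom φ)) (add_comm 1 0) (hC.elim _ _)
  obtain ⟨ψ, rfl⟩ := (Ext.mk₀_bijective _ _).2 y
  rw [Ext.mk₀_comp_mk₀] at hy
  refine ⟨ψ.hom, ?_⟩
  have := congrArg ModuleCat.Hom.hom ((Ext.mk₀_bijective _ _).1 hy)
  simpa using this

/-- If linear maps to `N` extend along `0 → A → B → C → 0` and `Ext^1(B, N) = 0`, then
`Ext^1(C, N) = 0`. -/
lemma ExtVanishes.one_of_exists_extension {f : A →ₗ[R] B} {g : B →ₗ[R] C}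
    (hf : Function.Injective f) (h : Function.Exact f g) (hg : Function.Surjective g)
    (hB : ExtVanishes R B N 1) (H : ∀ φ : A →ₗ[R] N, ∃ ψ : B →ₗ[R] N, ψ ∘ₗ f = φ) :
    ExtVanishes R C N 1 := by
  have hS := moduleShortComplex_shortExact hf h hg
  unfold ExtVanishes at *
  refine subsingleton_of_forall_eq 0 fun x ↦ ?_
  obtain ⟨y, rfl⟩ := Ext.contravariant_sequence_exact₃ hS (ModuleCat.of R N) x
    (hB.elim _ _) (add_comm 1 0)
  -- The class is the extension class pushed out along `φ`; it dies once `φ` factors through `f`.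
  obtain ⟨φ, rfl⟩ := (Ext.mk₀_bijective _ _).2 y
  obtain ⟨ψ, hψ⟩ := H φ.hom
  have : φ = (moduleShortComplex f g h).f ≫ ModuleCat.ofHom ψ := by
    ext1; exact hψ.symm
  rw [this, ← Ext.mk₀_comp_mk₀]
  exact hS.extClass_comp_assoc _

lemma ExtVanishes.of_projective [Module.Projective R A] {i : ℕ} (hi : 0 < i) :
    ExtVanishes R A N i := by
  obtain ⟨i, rfl⟩ := Nat.exists_eq_succ_of_ne_zero hi.ne'
  have : Projective (ModuleCat.of R A) := (IsProjective.iff_projective A).mp inferInstance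
  exact Ext.subsingleton_of_projective _ _ _

lemma ExtVanishes.of_exact_target {f : A →ₗ[R] B} {g : B →ₗ[R] C}
    (hf : Function.Injective f) (h : Function.Exact f g) (hg : Function.Surjective g)
    {i : ℕ} (hB : ExtVanishes R N B i) (hA : ExtVanishes R N A (i + 1)) :
    ExtVanishes R N C i := by
  have hS := moduleShortComplex_shortExact hf h hg
  unfold ExtVanishes at *
  refine subsingleton_of_forall_eq 0 fun x ↦ ?_
  obtain ⟨y, rfl⟩ := Ext.covariant_sequence_exact₃ (ModuleCat.of R N) hS x rfl (hA.elim _ _)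
  rw [show y = 0 from hB.elim _ _, Ext.zero_comp]

lemma ExtVanishes.congr_left (e : A ≃ₗ[R] B) {i : ℕ} (h : ExtVanishes R A N i) :
    ExtVanishes R B N i := by
  obtain ⟨E⟩ : Nonempty (ModuleCat.of R A ≅ ModuleCat.of R B) := ⟨e.toModuleIso⟩
  unfold ExtVanishes at *
  refine subsingleton_of_forall_eq 0 fun x ↦ ?_
  have h1 : (Ext.mk₀ E.hom).comp x (zero_add i) = 0 := h.elim _ _
  have h2 := congrArg (fun y ↦ (Ext.mk₀ E.inv).comp y (zero_add i)) h1
  simpa using h2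

lemma ExtVanishes.congr_right (e : A ≃ₗ[R] B) {i : ℕ} (h : ExtVanishes R N A i) :
    ExtVanishes R N B i := by
  obtain ⟨E⟩ : Nonempty (ModuleCat.of R A ≅ ModuleCat.of R B) := ⟨e.toModuleIso⟩
  unfold ExtVanishes at *
  refine subsingleton_of_forall_eq 0 fun x ↦ ?_
  have h1 : x.comp (Ext.mk₀ E.inv) (add_zero i) = 0 := h.elim _ _
  have h2 := congrArg (fun y ↦ y.comp (Ext.mk₀ E.hom) (add_zero i)) h1
  simpa using h2

end ExtSequences

/-! ### Totally reflexive modules: extensions and cosyzygies. -/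

section TotallyReflexive

variable {R : Type u} [CommRing R] {A B C G X : Type u} [AddCommGroup A] [Module R A]
  [AddCommGroup B] [Module R B] [AddCommGroup C] [Module R C] [AddCommGroup G] [Module R G]
  [AddCommGroup X] [Module R X]

lemma dualMap_exact {f : A →ₗ[R] B} {g : B →ₗ[R] C} (h : Function.Exact f g)
    (hg : Function.Surjective g) : Function.Exact g.dualMap f.dualMap :=
  LinearMap.exact_lcomp_of_exact_of_surjective R h hg

lemma dualMap_surjective_of_extVanishes {f : A →ₗ[R] B} {g : B →ₗ[R] C}
    (hf : Function.Injective f) (h : Function.Exact f g) (hg : Function.Surjective g)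
    (hC : ExtVanishes R C R 1) : Function.Surjective f.dualMap := fun φ ↦ by
  obtain ⟨ψ, hψ⟩ := hC.exists_extension hf h hg φ
  exact ⟨ψ, hψ⟩

/-- Totally reflexive modules are closed under extensions. -/
lemma IsTotallyReflexive.of_exact {f : A →ₗ[R] B} {g : B →ₗ[R] C}
    (hf : Function.Injective f) (h : Function.Exact f g) (hg : Function.Surjective g)
    (hA : IsTotallyReflexive R A) (hC : IsTotallyReflexive R C) : IsTotallyReflexive R B := by
  have hf' : Function.Surjective f.dualMap :=
    dualMap_surjective_of_extVanishes hf h hg (hC.ext_vanishes 1 one_pos)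
  have h' := dualMap_exact h hg
  have hg' : Function.Injective g.dualMap := LinearMap.dualMap_injective_of_surjective hg
  have hg'' : Function.Surjective g.dualMap.dualMap :=
    dualMap_surjective_of_extVanishes hg' h' hf' (hA.ext_dual_vanishes 1 one_pos)
  have hf'' : Function.Injective f.dualMap.dualMap :=
    LinearMap.dualMap_injective_of_surjective hf'
  have h'' := dualMap_exact h' hf'
  have := hA.finite
  have := hC.finite
  refine ⟨Module.Finite.of_exact h hg, ?_, fun i hi ↦ ?_, fun i hi ↦ ?_⟩
  -- Five lemma with zero modules at both ends, comparing the sequence with its double dual.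
  · refine LinearMap.bijective_of_surjective_of_bijective_of_bijective_of_injective
      (0 : Unit →ₗ[R] A) f g (0 : C →ₗ[R] Unit)
      (0 : Unit →ₗ[R] _) f.dualMap.dualMap g.dualMap.dualMap (0 : _ →ₗ[R] Unit)
      0 (Module.Dual.eval R A) (Module.Dual.eval R B) (Module.Dual.eval R C) 0
      (by simp) rfl rfl (by simp) ?_ h ?_ ?_ h'' ?_
      (fun x ↦ ⟨0, rfl⟩) hA.bijective_eval hC.bijective_eval (fun _ _ _ ↦ rfl)
    · rw [LinearMap.exact_zero_iff_injective]; exact hf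
    · rw [LinearMap.exact_zero_iff_surjective]; exact hg
    · rw [LinearMap.exact_zero_iff_injective]; exact hf''
    · rw [LinearMap.exact_zero_iff_surjective]; exact hg''
  · exact .of_exact_middle hf h hg (hA.ext_vanishes i hi) (hC.ext_vanishes i hi)
  · exact .of_exact_middle hg' h' hf' (hC.ext_dual_vanishes i hi) (hA.ext_dual_vanishes i hi)

/-- A totally reflexive module embeds in a finite projective module with totally reflexive
cokernel. -/
lemma IsTotallyReflexive.exists_cosyzygy [IsNoetherianRing R] (hG : IsTotallyReflexive R G) :
    ∃ (F C : Type u) (_ : AddCommGroup F) (_ : Module R F) (_ : AddCommGroup C) (_ : Module R C)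
      (f : G →ₗ[R] F) (g : F →ₗ[R] C), Module.Finite R F ∧ Module.Projective R F ∧
      IsTotallyReflexive R C ∧ Function.Injective f ∧ Function.Exact f g ∧
      Function.Surjective g := by
  have := hG.finite
  -- Dualizing `0 → K → F → G* → 0` and identifying `G` with `G**` gives `0 → G → F* → K* → 0`, so
  -- the cosyzygy is `K*`.
  obtain ⟨F, _, _, _, _, p, hp⟩ := Module.exists_finite_presentation R (Module.Dual R G)
  let K := LinearMap.ker p
  have hK : Function.Exact K.subtype p := LinearMap.exact_subtype_ker_map p
  have hKi : Function.Injective K.subtype := K.injective_subtype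
  have hpe := dualMap_exact hK hp
  let f : G →ₗ[R] Module.Dual R F := p.dualMap ∘ₗ Module.Dual.eval R G
  let g : Module.Dual R F →ₗ[R] Module.Dual R K := K.subtype.dualMap
  have hfi : Function.Injective f :=
    (LinearMap.dualMap_injective_of_surjective hp).comp hG.bijective_eval.1
  have hfg : Function.Exact f g := fun ξ ↦ by
    rw [hpe ξ]
    constructor
    · rintro ⟨θ, rfl⟩
      obtain ⟨m, rfl⟩ := hG.bijective_eval.2 θ
      exact ⟨m, rfl⟩
    · rintro ⟨m, rfl⟩
      exact ⟨_, rfl⟩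
  have hgs : Function.Surjective g :=
    dualMap_surjective_of_extVanishes hKi hK hp (hG.ext_dual_vanishes 1 one_pos)
  have hKb : Function.Bijective (Module.Dual.eval R K) := by
    constructor
    · intro x y hxy
      apply hKi
      apply (Module.bijective_dual_eval R F).1
      ext ξ
      exact LinearMap.congr_fun hxy (g ξ)
    -- Reflexivity of `F` represents `θ ∘ g` by some `x` in `F`; since `g ∘ f = 0`, the functional
    -- `p x` vanishes on `G`, so `x` lies in `K`.
    · intro θ
      obtain ⟨x, hx⟩ := (Module.bijective_dual_eval R F).2 (θ ∘ₗ g)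
      have hx' : ∀ ξ : Module.Dual R F, ξ x = θ (g ξ) := fun ξ ↦ LinearMap.congr_fun hx ξ
      have hxK : x ∈ K := by
        rw [LinearMap.mem_ker]
        ext m
        have := hx' (f m)
        rw [hfg.apply_apply_eq_zero, map_zero] at this
        exact this
      refine ⟨⟨x, hxK⟩, ?_⟩
      ext ξ
      obtain ⟨η, rfl⟩ := hgs ξ
      exact hx' η
  have : Module.IsReflexive R K := ⟨hKb⟩
  refine ⟨Module.Dual R F, Module.Dual R K, inferInstance, inferInstance, inferInstance,
    inferInstance, f, g, inferInstance, inferInstance, ⟨inferInstance,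
      Module.bijective_dual_eval R _, fun i hi ↦ ?_, fun i hi ↦ ?_⟩, hfi, hfg, hgs⟩
  · obtain ⟨i, rfl⟩ := Nat.exists_eq_succ_of_ne_zero hi.ne'
    rcases Nat.eq_zero_or_pos i with rfl | hi
    · refine .one_of_exists_extension hfi hfg hgs (.of_projective one_pos) fun φ ↦ ?_
      obtain ⟨x, rfl⟩ := hp φ
      exact ⟨Module.Dual.eval R F x, by ext m; rfl⟩
    · exact .of_exact_right hfi hfg hgs (hG.ext_vanishes i hi) (.of_projective (by simp))
  · exact .congr_left (LinearEquiv.ofBijective _ hKb)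
      (.of_exact_left hKi hK hp (.of_projective hi) (hG.ext_dual_vanishes (i + 1) (by simp)))

/-- `Ext^i(G, X)` vanishes for `i > 0`, `G` totally reflexive and `X` of finite injective
dimension. -/
lemma IsTotallyReflexive.extVanishes_of_hasInjectiveDimensionLT [IsNoetherianRing R] {n : ℕ}
    [HasInjectiveDimensionLT (ModuleCat.of R X) n] (hG : IsTotallyReflexive R G)
    {i : ℕ} (hi : 0 < i) : ExtVanishes R G X i := by
  -- Each cosyzygy raises the Ext degree by one; `m` counts the steps needed to reach the injective
  -- dimension bound.
  obtain ⟨m, hm⟩ : ∃ m, n ≤ i + m := ⟨n, by lia⟩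
  induction m generalizing i G with
  | zero => exact HasInjectiveDimensionLT.subsingleton _ n i hm _
  | succ m ih =>
    obtain ⟨F, C, _, _, _, _, f, g, _, _, hC, hf, h, hg⟩ := hG.exists_cosyzygy
    exact .of_exact_left hf h hg (.of_projective hi) (ih hC (Nat.succ_pos i) (by lia))

end TotallyReflexive

/-! ### Pushouts and quotients of short exact sequences. -/

section Pushout

variable {R : Type u} [CommRing R] {K P G C X : Type u} [AddCommGroup K] [Module R K]
  [AddCommGroup P] [Module R P] [AddCommGroup G] [Module R G] [AddCommGroup C] [Module R C]
  [AddCommGroup X] [Module R X]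

/-- The pushout of two short exact sequences `0 → K → P → C → 0` and `0 → K → G → X → 0`. -/
lemma exists_pushout_exact {a : K →ₗ[R] P} {b : P →ₗ[R] C} {e : K →ₗ[R] G} {q : G →ₗ[R] X}
    (ha : Function.Injective a) (hab : Function.Exact a b) (hb : Function.Surjective b)
    (he : Function.Injective e) (heq : Function.Exact e q) (hq : Function.Surjective q) :
    ∃ (W : Type u) (_ : AddCommGroup W) (_ : Module R W) (j : G →ₗ[R] W) (b' : W →ₗ[R] C)
      (i : P →ₗ[R] W) (q' : W →ₗ[R] X),
      (Function.Injective j ∧ Function.Exact j b' ∧ Function.Surjective b') ∧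
      (Function.Injective i ∧ Function.Exact i q' ∧ Function.Surjective q') := by
  let S : Submodule R (P × G) := LinearMap.range (a.prod (-e))
  have hS : ∀ k, (a k, -e k) ∈ S := fun k ↦ ⟨k, rfl⟩
  let b' : ((P × G) ⧸ S) →ₗ[R] C := S.liftQ (b ∘ₗ LinearMap.fst R P G) (by
    rintro _ ⟨k, rfl⟩
    exact hab.apply_apply_eq_zero k)
  let q' : ((P × G) ⧸ S) →ₗ[R] X := S.liftQ (q ∘ₗ LinearMap.snd R P G) (by
    rintro _ ⟨k, rfl⟩
    simp [heq.apply_apply_eq_zero k])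
  refine ⟨(P × G) ⧸ S, inferInstance, inferInstance, S.mkQ ∘ₗ LinearMap.inr R P G, b',
    S.mkQ ∘ₗ LinearMap.inl R P G, q', ⟨?_, ?_, ?_⟩, ⟨?_, ?_, ?_⟩⟩
  · rw [injective_iff_map_eq_zero]
    intro g hg
    obtain ⟨k, hk⟩ := (Submodule.Quotient.mk_eq_zero S).1 hg
    obtain ⟨h1, h2⟩ := Prod.ext_iff.1 hk
    obtain rfl : k = 0 := ha (by simpa using h1)
    simpa using h2.symm
  · intro w
    obtain ⟨⟨p, g⟩, rfl⟩ := S.mkQ_surjective w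
    constructor
    · intro h
      obtain ⟨k, rfl⟩ := (hab p).1 h
      refine ⟨g + e k, (Submodule.Quotient.eq S).2 ?_⟩
      convert hS (-k) using 1
      simp
    · rintro ⟨g', hg'⟩
      rw [← hg']
      exact map_zero b
  · intro c
    obtain ⟨p, rfl⟩ := hb c
    exact ⟨S.mkQ (p, 0), rfl⟩
  · rw [injective_iff_map_eq_zero]
    intro p hp
    obtain ⟨k, hk⟩ := (Submodule.Quotient.mk_eq_zero S).1 hp
    obtain ⟨h1, h2⟩ := Prod.ext_iff.1 hk
    obtain rfl : k = 0 := he (by simpa using h2)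
    simpa using h1.symm
  · intro w
    obtain ⟨⟨p, g⟩, rfl⟩ := S.mkQ_surjective w
    constructor
    · intro h
      obtain ⟨k, rfl⟩ := (heq g).1 h
      refine ⟨p + a k, (Submodule.Quotient.eq S).2 ?_⟩
      convert hS k using 1
      simp
    · rintro ⟨g', hg'⟩
      rw [← hg']
      exact map_zero q
  · intro x
    obtain ⟨g, rfl⟩ := hq x
    exact ⟨S.mkQ (0, g), rfl⟩

/-- Given `0 → P → G → X → 0` and `0 → G → K → C → 0`, the cokernel of `P → K` is an extension
of `C` by `X`. -/
lemma exists_exact_quotient {i : P →ₗ[R] G} {q : G →ₗ[R] X} {c : G →ₗ[R] K} {d : K →ₗ[R] C}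
    (hiq : Function.Exact i q) (hq : Function.Surjective q)
    (hc : Function.Injective c) (hcd : Function.Exact c d) (hd : Function.Surjective d) :
    ∃ (f : X →ₗ[R] K ⧸ LinearMap.range (c ∘ₗ i)) (g : (K ⧸ LinearMap.range (c ∘ₗ i)) →ₗ[R] C),
      Function.Injective f ∧ Function.Exact f g ∧ Function.Surjective g := by
  let S := LinearMap.range (c ∘ₗ i)
  have hker : LinearMap.ker q = LinearMap.range i := LinearMap.exact_iff.1 hiq
  let f : X →ₗ[R] K ⧸ S := ((LinearMap.ker q).liftQ (S.mkQ ∘ₗ c) (by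
    rw [hker]
    rintro _ ⟨p, rfl⟩
    exact (Submodule.Quotient.mk_eq_zero S).2 ⟨p, rfl⟩)) ∘ₗ
      (q.quotKerEquivOfSurjective hq).symm.toLinearMap
  have hf : ∀ w, f (q w) = S.mkQ (c w) := fun w ↦ by
    have : (q.quotKerEquivOfSurjective hq).symm (q w) = Submodule.Quotient.mk w := by
      rw [LinearEquiv.symm_apply_eq]; rfl
    simp [f, this]
  refine ⟨f, S.liftQ d ?_, ?_, ?_, ?_⟩
  · rintro _ ⟨p, rfl⟩
    exact hcd.apply_apply_eq_zero _
  · rw [injective_iff_map_eq_zero]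
    intro x hx
    obtain ⟨w, rfl⟩ := hq x
    rw [hf] at hx
    obtain ⟨p, hp⟩ := (Submodule.Quotient.mk_eq_zero S).1 hx
    rw [← hc hp]
    exact hiq.apply_apply_eq_zero p
  · intro y
    obtain ⟨y, rfl⟩ := S.mkQ_surjective y
    constructor
    · intro h
      obtain ⟨w, rfl⟩ := (hcd y).1 h
      exact ⟨q w, hf w⟩
    · rintro ⟨x, hx⟩
      obtain ⟨w, rfl⟩ := hq x
      rw [← hx, hf]
      exact hcd.apply_apply_eq_zero w
  · intro z
    obtain ⟨y, rfl⟩ := hd z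
    exact ⟨S.mkQ y, rfl⟩

end Pushout

/-! ### Hulls of finite projective dimension. -/

section Hull

variable {R : Type u} [CommRing R]

/-- A module of finite G-dimension embeds in a module of finite projective dimension with
totally reflexive cokernel. -/
lemma GDimLE.exists_hull [IsNoetherianRing R] {n : ℕ} (X : Type u) [AddCommGroup X] [Module R X]
    (hX : GDimLE R n X) :
    ∃ (P C : Type u) (_ : AddCommGroup P) (_ : Module R P) (_ : AddCommGroup C) (_ : Module R C)
      (f : X →ₗ[R] P) (g : P →ₗ[R] C), HasProjectiveDimensionLT (ModuleCat.of R P) (n + 1) ∧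
      IsTotallyReflexive R C ∧ Function.Injective f ∧ Function.Exact f g ∧
      Function.Surjective g := by
  induction n generalizing X with
  | zero =>
    obtain ⟨F, C, _, _, _, _, f, g, _, _, hC, hf, h, hg⟩ := IsTotallyReflexive.exists_cosyzygy hX
    have : Projective (ModuleCat.of R F) := (IsProjective.iff_projective F).mp inferInstance
    exact ⟨F, C, _, _, _, _, f, g, inferInstance, hC, hf, h, hg⟩
  | succ n ih =>
    obtain ⟨G, _, _, q, hG, hq, hK⟩ := hX
    obtain ⟨P, C, _, _, _, _, a, b, hP, hC, ha, hab, hb⟩ := ih _ hK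
    -- The pushout `W` of `P ← ker q → G` extends `C` by `G`, hence is totally reflexive, and also
    -- extends `X` by `P`. Embedding `W` in a projective `F` makes `F/P` the required hull of `X`.
    obtain ⟨W, _, _, j, b', i, q', ⟨hj, hjb, hb'⟩, hi, hiq, hq'⟩ := exists_pushout_exact ha hab hb
      (LinearMap.ker q).injective_subtype (LinearMap.exact_subtype_ker_map q) hq
    have hW : IsTotallyReflexive R W := .of_exact hj hjb hb' hG hC
    obtain ⟨F, D, _, _, _, _, c, d, _, _, hD, hc, hcd, hd⟩ := hW.exists_cosyzygy
    obtain ⟨f, g, hf, hfg, hg⟩ := exists_exact_quotient hiq hq' hc hcd hd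
    have : Projective (ModuleCat.of R F) := (IsProjective.iff_projective F).mp inferInstance
    refine ⟨F ⧸ LinearMap.range (c ∘ₗ i), D, inferInstance, inferInstance, inferInstance,
      inferInstance, f, g, ?_, hD, hf, hfg, hg⟩
    exact (moduleShortComplex_shortExact (f := c ∘ₗ i) (by exact hc.comp hi)
      (c ∘ₗ i).exact_map_mkQ_range (Submodule.mkQ_surjective _)).hasProjectiveDimensionLT_X₃
      (n + 1) hP inferInstance

end Hull

/-! ### An injective module with simple socle. -/

section InjectiveHull

variable {R : Type u} [CommRing R]

lemma Module.Injective.of_retraction {J N : Type u} [AddCommGroup J] [Module R J]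
    [AddCommGroup N] [Module R N] (hJ : Module.Injective R J) (i : N →ₗ[R] J) (r : J →ₗ[R] N)
    (h : ∀ x, r (i x) = x) : Module.Injective R N where
  out X Y _ _ _ _ f hf g := by
    obtain ⟨φ, hφ⟩ := hJ.out f hf (i ∘ₗ g)
    exact ⟨r ∘ₗ φ, fun x ↦ by simp [hφ, h]⟩

/-- A submodule maximal among those disjoint from `N`. -/
lemma exists_maximal_disjoint {J : Type u} [AddCommGroup J] [Module R J] (N : Submodule R J) :
    ∃ C : Submodule R J, Maximal (fun C ↦ Disjoint C N) C := by
  obtain ⟨C, -, hC⟩ := zorn_le_nonempty₀ {C : Submodule R J | Disjoint C N}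
    (fun c hc hch y hy ↦ ⟨sSup c, Submodule.disjoint_def.2 fun x hx hxN ↦ by
      obtain ⟨z, hz, hxz⟩ := (Submodule.mem_sSup_of_directed ⟨y, hy⟩ hch.directedOn).1 hx
      exact Submodule.disjoint_def.1 (hc hz) x hxz hxN, fun z hz ↦ le_sSup hz⟩)
    ⊥ disjoint_bot_left
  exact ⟨C, hC⟩

variable (R) [IsLocalRing R]

open IsLocalRing

/-- Existence of the injective hull of the residue field: an injective module whose socle is
simple, spanned by `e`. -/
lemma exists_injective_simple_socle :
    ∃ (E : Type u) (_ : AddCommGroup E) (_ : Module R E) (e : E), Module.Injective R E ∧ e ≠ 0 ∧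
      (∀ r ∈ maximalIdeal R, r • e = 0) ∧
      ∀ x : E, (∀ r ∈ maximalIdeal R, r • x = 0) → x ∈ Submodule.span R {e} := by
  obtain ⟨⟨J, hJ, ι, hι⟩⟩ := EnoughInjectives.presentation (ModuleCat.of R (ResidueField R))
  have hJ : Module.Injective R J := Module.injective_module_of_injective_object R J
  have hι : Function.Injective ι.hom := (ModuleCat.mono_iff_injective _).1 hι
  let e : J := ι.hom (1 : ResidueField R)
  have he : e ≠ 0 := fun h ↦ one_ne_zero (hι (h.trans (map_zero ι.hom).symm))
  have hme : ∀ r ∈ maximalIdeal R, r • e = 0 := fun r hr ↦ by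
    have : r • (1 : ResidueField R) = 0 := by
      rw [Algebra.smul_def, mul_one]
      exact (residue_eq_zero_iff r).2 hr
    rw [← map_smul]
    exact (congrArg ι.hom this).trans (map_zero _)
  -- A submodule of the injective `J` maximal for `Q` turns out to be a retract of `J`, hence
  -- injective.
  let Q : Submodule R J → Prop := fun N ↦ e ∈ N ∧
    ∀ x ∈ N, (∀ r ∈ maximalIdeal R, r • x = 0) → x ∈ Submodule.span R {e}
  obtain ⟨N, -, hN⟩ := zorn_le_nonempty₀ {N : Submodule R J | Q N}
    (fun c hc hch y hy ↦ ⟨sSup c, ⟨le_sSup hy (hc hy).1, fun x hx hmx ↦ by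
      obtain ⟨z, hz, hxz⟩ := (Submodule.mem_sSup_of_directed ⟨y, hy⟩ hch.directedOn).1 hx
      exact (hc hz).2 x hxz hmx⟩, fun z hz ↦ le_sSup hz⟩)
    (Submodule.span R {e}) ⟨Submodule.mem_span_singleton_self e, fun x hx _ ↦ hx⟩
  obtain ⟨C, hC⟩ := exists_maximal_disjoint N
  have hdisj : ∀ x ∈ C, x ∈ N → x = 0 := Submodule.disjoint_def.1 hC.prop
  -- `N` embeds in `J/C`, and its inclusion in `J` extends to `φ` on `J/C`. Once the range of `φ` is
  -- shown to satisfy `Q`, maximality forces it to be `N`, and `φ ∘ C.mkQ` retracts `J` onto `N`.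
  obtain ⟨φ, hφ⟩ := hJ.out (C.mkQ ∘ₗ N.subtype) (by
    rw [injective_iff_map_eq_zero]
    rintro ⟨x, hx⟩ h
    exact Subtype.ext (hdisj x ((Submodule.Quotient.mk_eq_zero C).1 h) hx)) N.subtype
  have hφN : ∀ x ∈ N, φ (C.mkQ x) = x := fun x hx ↦ hφ ⟨x, hx⟩
  have hφi : Function.Injective φ := by
    rw [injective_iff_map_eq_zero]
    intro y hy
    obtain ⟨y, rfl⟩ := C.mkQ_surjective y
    have hle : C ≤ LinearMap.ker (φ ∘ₗ C.mkQ) := fun z hz ↦ by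
      simp [(Submodule.Quotient.mk_eq_zero C).2 hz]
    have hdis : Disjoint (LinearMap.ker (φ ∘ₗ C.mkQ)) N :=
      Submodule.disjoint_def.2 fun z hz hzN ↦ (hφN z hzN).symm.trans hz
    exact (Submodule.Quotient.mk_eq_zero C).2 (hC.le_of_ge hdis hle hy)
  have hQ : Q (LinearMap.range φ) := by
    refine ⟨⟨_, hφN e hN.prop.1⟩, ?_⟩
    rintro _ ⟨y, rfl⟩ hmy
    obtain ⟨y, rfl⟩ := C.mkQ_surjective y
    by_cases hy : y ∈ C
    · rw [Submodule.mkQ_apply, (Submodule.Quotient.mk_eq_zero C).2 hy, map_zero]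
      exact zero_mem _
    have hnd : ¬ Disjoint (C ⊔ Submodule.span R {y}) N := fun h ↦
      hy (hC.le_of_ge h le_sup_left (Submodule.mem_sup_right (Submodule.mem_span_singleton_self y)))
    obtain ⟨n, hn, hnN, hn0⟩ : ∃ n ∈ C ⊔ Submodule.span R {y}, n ∈ N ∧ n ≠ 0 := by
      rw [Submodule.disjoint_def] at hnd
      push Not at hnd
      exact hnd
    obtain ⟨c, hc, z, hz, rfl⟩ := Submodule.mem_sup.1 hn
    obtain ⟨r, rfl⟩ := Submodule.mem_span_singleton.1 hz
    have hmk : C.mkQ (c + r • y) = r • C.mkQ y := by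
      rw [map_add, map_smul, Submodule.mkQ_apply, (Submodule.Quotient.mk_eq_zero C).2 hc, zero_add]
    have hval : r • φ (C.mkQ y) = c + r • y := by
      rw [← map_smul, ← hmk, hφN _ hnN]
    have hr : IsUnit r := by
      by_contra hr
      exact hn0 (hval.symm.trans (hmy r hr))
    refine hN.prop.2 _ ?_ hmy
    rw [← Submodule.smul_mem_iff_of_isUnit N hr, hval]
    exact hnN
  have hNle : N ≤ LinearMap.range φ := fun x hx ↦ ⟨_, hφN x hx⟩
  have hrange : LinearMap.range φ ≤ N := hN.le_of_ge hQ hNle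
  refine ⟨N, inferInstance, inferInstance, ⟨e, hN.prop.1⟩,
    hJ.of_retraction N.subtype ((φ ∘ₗ C.mkQ).codRestrict N fun x ↦ hrange ⟨_, rfl⟩)
      (fun x ↦ Subtype.ext (hφN x x.2)), fun h ↦ he (congrArg Subtype.val h),
    fun r hr ↦ Subtype.ext (hme r hr), fun x hx ↦ ?_⟩
  obtain ⟨r, hr⟩ := Submodule.mem_span_singleton.1
    (hN.prop.2 x x.2 fun r hr ↦ congrArg Subtype.val (hx r hr))
  exact Submodule.mem_span_singleton.2 ⟨r, Subtype.ext hr⟩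

end InjectiveHull

/-! ### Duality into an injective module. -/

section MatlisDual

variable {R : Type u} [CommRing R] {A B C E N : Type u} [AddCommGroup A] [Module R A]
  [AddCommGroup B] [Module R B] [AddCommGroup C] [Module R C] [AddCommGroup E] [Module R E]
  [AddCommGroup N] [Module R N]

lemma lcomp_surjective_of_injective [hE : Module.Injective R E] {f : A →ₗ[R] B}
    (hf : Function.Injective f) : Function.Surjective (f.lcomp R E) := fun g ↦ by
  obtain ⟨h, hh⟩ := hE.out f hf g
  exact ⟨h, LinearMap.ext hh⟩

/-- By tensor-hom adjunction, extending a map into `N →ₗ[R] E` amounts to extending a map from a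
tensor product with the flat module `N` into `E`. -/
instance Module.Injective.linearMap_of_projective [Module.Projective R N]
    [hE : Module.Injective R E] : Module.Injective R (N →ₗ[R] E) where
  out X Y _ _ _ _ f hf g := by
    obtain ⟨φ, hφ⟩ := hE.out (f.rTensor N) (Module.Flat.rTensor_preserves_injective_linearMap f hf)
      (TensorProduct.lift g)
    refine ⟨TensorProduct.curry φ, fun x ↦ ?_⟩
    ext n
    simpa using hφ (TensorProduct.tmul R x n)

/-- The dual of a module of finite projective dimension into an injective module has finite
injective dimension. -/
lemma hasInjectiveDimensionLT_linearMap [Module.Injective R E] {n : ℕ}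
    (P : Type u) [AddCommGroup P] [Module R P]
    (hP : HasProjectiveDimensionLT (ModuleCat.of R P) (n + 1)) :
    HasInjectiveDimensionLT (ModuleCat.of R (P →ₗ[R] E)) (n + 1) := by
  induction n generalizing P with
  | zero =>
    have : Projective (ModuleCat.of R P) := projective_iff_hasProjectiveDimensionLT_one.2 hP
    have : Module.Projective R P := (IsProjective.iff_projective P).2 this
    have : Injective (ModuleCat.of R (P →ₗ[R] E)) :=
      Module.injective_object_of_injective_module R _
    infer_instance
  | succ n ih =>
    let p : (P →₀ R) →ₗ[R] P := Finsupp.linearCombination R id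
    have hp : Function.Surjective p := Finsupp.linearCombination_id_surjective R P
    obtain ⟨K, _, _, j, hKi, hK⟩ : ∃ (K : Type u) (_ : AddCommGroup K) (_ : Module R K)
        (j : K →ₗ[R] (P →₀ R)), Function.Injective j ∧ Function.Exact j p :=
      ⟨LinearMap.ker p, inferInstance, inferInstance, (LinearMap.ker p).subtype,
        (LinearMap.ker p).injective_subtype, LinearMap.exact_subtype_ker_map p⟩
    have hpr : Projective (ModuleCat.of R (P →₀ R)) :=
      (IsProjective.iff_projective _).1 inferInstance
    have hKd : HasProjectiveDimensionLT (ModuleCat.of R K) (n + 1) :=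
      ((moduleShortComplex_shortExact hKi hK hp).hasProjectiveDimensionLT_X₃_iff n hpr).1 hP
    have hin : Injective (ModuleCat.of R ((P →₀ R) →ₗ[R] E)) :=
      Module.injective_object_of_injective_module R _
    exact ((moduleShortComplex_shortExact (f := p.lcomp R E) (g := j.lcomp R E)
      (LinearMap.lcomp_injective_of_surjective p hp)
      (LinearMap.exact_lcomp_of_exact_of_surjective E hK hp)
      (lcomp_surjective_of_injective hKi)).hasInjectiveDimensionLT_X₃_iff n hin).1 (ih K hKd)

section Local

variable [IsLocalRing R]

open IsLocalRing

/-- The residue field embeds in `E`, hence `E` is a cogenerator. -/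
lemma exists_linearMap_ne_zero [hE : Module.Injective R E] {e : E} (he : e ≠ 0)
    (hme : ∀ r ∈ maximalIdeal R, r • e = 0) {x : N} (hx : x ≠ 0) :
    ∃ φ : N →ₗ[R] E, φ x ≠ 0 := by
  let I := LinearMap.ker (LinearMap.toSpanSingleton R N x)
  have hI : I ≤ maximalIdeal R := le_maximalIdeal fun h ↦ hx (by
    have : (1 : R) ∈ I := h ▸ Submodule.mem_top
    simpa [I] using this)
  obtain ⟨φ, hφ⟩ := hE.out (I.liftQ (LinearMap.toSpanSingleton R N x) le_rfl)
    (LinearMap.ker_eq_bot.1 (Submodule.ker_liftQ_eq_bot _ _ _ le_rfl))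
    (I.liftQ (LinearMap.toSpanSingleton R E e) fun r hr ↦ hme r (hI hr))
  refine ⟨φ, ?_⟩
  have := hφ (I.mkQ 1)
  simp only [Submodule.mkQ_apply, Submodule.liftQ_apply, LinearMap.toSpanSingleton_apply,
    one_smul] at this
  rw [this]
  erw [Submodule.liftQ_apply]
  simpa using he

/-- A map out of a simple module is determined by the image of a generator, which is killed by the
maximal ideal and so lies in the simple socle of `E`. -/
lemma length_linearMap_le_of_isSimpleModule {e : E} (he : e ≠ 0)
    (hme : ∀ r ∈ maximalIdeal R, r • e = 0)
    (hsoc : ∀ x : E, (∀ r ∈ maximalIdeal R, r • x = 0) → x ∈ Submodule.span R {e})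
    [IsSimpleModule R N] : Module.length R (N →ₗ[R] E) ≤ 1 := by
  obtain ⟨I, hI, ⟨eN⟩⟩ := isSimpleModule_iff_quot_maximal.1 ‹IsSimpleModule R N›
  obtain rfl := eq_maximalIdeal hI
  have hk : LinearMap.ker (LinearMap.toSpanSingleton R E e) = maximalIdeal R :=
    le_antisymm (le_maximalIdeal fun h ↦ he (by
      have : (1 : R) ∈ LinearMap.ker (LinearMap.toSpanSingleton R E e) := h ▸ Submodule.mem_top
      simpa using this)) hme
  let f : (N →ₗ[R] E) →ₗ[R] E := LinearMap.applyₗ (eN.symm (Submodule.Quotient.mk 1))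
  have hgen : ∀ y : N, ∃ r : R, y = r • eN.symm (Submodule.Quotient.mk 1) := fun y ↦ by
    obtain ⟨r, hr⟩ := Submodule.mkQ_surjective _ (eN y)
    refine ⟨r, eN.injective ?_⟩
    rw [map_smul, LinearEquiv.apply_symm_apply, ← hr, ← Submodule.Quotient.mk_smul, smul_eq_mul,
      mul_one]
    rfl
  have hf : Function.Injective f := by
    rw [injective_iff_map_eq_zero]
    intro φ hφ
    ext y
    obtain ⟨r, rfl⟩ := hgen y
    rw [map_smul]
    exact (congrArg (r • ·) hφ).trans (smul_zero r)
  have hfm : ∀ φ, f φ ∈ LinearMap.range (LinearMap.toSpanSingleton R E e) := fun φ ↦ by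
    rw [LinearMap.range_toSpanSingleton]
    refine hsoc _ fun r hr ↦ ?_
    change r • φ (eN.symm (Submodule.Quotient.mk 1)) = 0
    rw [← map_smul, ← map_smul, ← Submodule.Quotient.mk_smul, smul_eq_mul, mul_one,
      (Submodule.Quotient.mk_eq_zero _).2 hr, map_zero, map_zero]
  have : IsSimpleModule R (R ⧸ maximalIdeal R) := IsSimpleModule.congr eN.symm
  calc Module.length R (N →ₗ[R] E)
      ≤ Module.length R (LinearMap.range (LinearMap.toSpanSingleton R E e)) :=
        Module.length_le_of_injective (f.codRestrict _ hfm) fun x y h ↦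
          hf (congrArg Subtype.val h)
    _ = Module.length R (R ⧸ maximalIdeal R) := by
        rw [← hk]
        exact (LinearMap.quotKerEquivRange _).length_eq.symm
    _ ≤ 1 := (Module.length_eq_one R _).le

/-- Exactness of `Hom(-, E)` makes lengths additive along a composition series. The inequality
suffices: applied twice, it forces the injective biduality map to be onto. -/
lemma length_linearMap_le [Module.Injective R E] {e : E} (he : e ≠ 0)
    (hme : ∀ r ∈ maximalIdeal R, r • e = 0)
    (hsoc : ∀ x : E, (∀ r ∈ maximalIdeal R, r • x = 0) → x ∈ Submodule.span R {e})
    (hN : IsFiniteLength R N) : Module.length R (N →ₗ[R] E) ≤ Module.length R N := by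
  induction hN with
  | of_subsingleton => simp
  | @of_simple_quotient M _ _ K hK _ ih =>
    have h1 := Module.length_eq_add_of_exact (K.mkQ.lcomp R E) (K.subtype.lcomp R E)
      (LinearMap.lcomp_injective_of_surjective _ K.mkQ_surjective)
      (lcomp_surjective_of_injective K.injective_subtype)
      (LinearMap.exact_lcomp_of_exact_of_surjective E (LinearMap.exact_subtype_mkQ K)
        K.mkQ_surjective)
    have h2 := Module.length_eq_add_of_exact K.subtype K.mkQ K.injective_subtype
      K.mkQ_surjective (LinearMap.exact_subtype_mkQ K)
    rw [h1, h2, add_comm]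
    gcongr
    rw [Module.length_eq_one R (M ⧸ K)]
    exact length_linearMap_le_of_isSimpleModule he hme hsoc

lemma isFiniteLength_linearMap [Module.Injective R E] {e : E} (he : e ≠ 0)
    (hme : ∀ r ∈ maximalIdeal R, r • e = 0)
    (hsoc : ∀ x : E, (∀ r ∈ maximalIdeal R, r • x = 0) → x ∈ Submodule.span R {e})
    (hN : IsFiniteLength R N) : IsFiniteLength R (N →ₗ[R] E) :=
  Module.length_ne_top_iff.1 ((length_linearMap_le he hme hsoc hN).trans_lt
    (Module.length_ne_top_iff.2 hN).lt_top).ne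

/-- Matlis duality for modules of finite length. -/
lemma bijective_applyₗ [Module.Injective R E] {e : E} (he : e ≠ 0)
    (hme : ∀ r ∈ maximalIdeal R, r • e = 0)
    (hsoc : ∀ x : E, (∀ r ∈ maximalIdeal R, r • x = 0) → x ∈ Submodule.span R {e})
    (hN : IsFiniteLength R N) :
    Function.Bijective (LinearMap.applyₗ : N →ₗ[R] (N →ₗ[R] E) →ₗ[R] E) := by
  have hinj : Function.Injective (LinearMap.applyₗ : N →ₗ[R] (N →ₗ[R] E) →ₗ[R] E) := by
    rw [injective_iff_map_eq_zero]
    intro x hx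
    by_contra h
    obtain ⟨φ, hφ⟩ := exists_linearMap_ne_zero he hme h
    exact hφ (LinearMap.congr_fun hx φ)
  refine ⟨hinj, LinearMap.range_eq_top.1 (by_contra fun h ↦ ?_)⟩
  have hD := isFiniteLength_linearMap he hme hsoc hN
  have hDD := isFiniteLength_linearMap he hme hsoc hD
  obtain ⟨_, _⟩ := isFiniteLength_iff_isNoetherian_isArtinian.1 hDD
  have h1 := Submodule.length_lt h
  rw [← (LinearEquiv.ofInjective _ hinj).length_eq] at h1
  exact (h1.trans_le ((length_linearMap_le he hme hsoc hD).trans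
    (length_linearMap_le he hme hsoc hN))).ne rfl

end Local

end MatlisDual

/-! ### The evaluation map from tensor to double Hom. -/

section HomEvaluation

open TensorProduct

variable {R : Type u} [CommRing R] {X Y B E : Type u} [AddCommGroup X] [Module R X]
  [AddCommGroup Y] [Module R Y] [AddCommGroup B] [Module R B] [AddCommGroup E] [Module R E]

variable (R X B E) in
/-- The evaluation map `X ⊗ Hom(B, E) → Hom(Hom(X, B), E)`. -/
noncomputable def homEvaluation : X ⊗[R] (B →ₗ[R] E) →ₗ[R] (X →ₗ[R] B) →ₗ[R] E :=
  TensorProduct.lift ((LinearMap.llcomp R (X →ₗ[R] B) B E).flip ∘ₗ LinearMap.applyₗ)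

@[simp]
lemma homEvaluation_tmul (x : X) (φ : B →ₗ[R] E) (h : X →ₗ[R] B) :
    homEvaluation R X B E (x ⊗ₜ φ) h = φ (h x) := rfl

lemma homEvaluation_naturality (f : X →ₗ[R] Y) :
    (f.lcomp R B).lcomp R E ∘ₗ homEvaluation R X B E =
      homEvaluation R Y B E ∘ₗ f.rTensor (B →ₗ[R] E) := by
  ext x φ h
  rfl

lemma homEvaluation_bijective_of_free [Module.Finite R X] [Module.Free R X] :
    Function.Bijective (homEvaluation R X B E) := by
  classical
  let b := Module.Free.chooseBasis R X
  -- Dual-basis inverse: `ψ` goes to the sum of `b j ⊗ (β ↦ ψ (b.coord j · β))`.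
  let τ : ((X →ₗ[R] B) →ₗ[R] E) →ₗ[R] X ⊗[R] (B →ₗ[R] E) :=
    ∑ j, TensorProduct.mk R X (B →ₗ[R] E) (b j) ∘ₗ
      (LinearMap.smulRightₗ (b.coord j)).lcomp R E
  have h1 : τ ∘ₗ homEvaluation R X B E = LinearMap.id := by
    ext x φ
    have : ∀ j, (homEvaluation R X B E (x ⊗ₜ φ)) ∘ₗ (LinearMap.smulRightₗ (b.coord j)) =
        b.repr x j • φ := fun j ↦ by
      ext β
      simp
    simp only [TensorProduct.AlgebraTensorModule.curry_apply, LinearMap.restrictScalars_self,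
      TensorProduct.curry_apply, LinearMap.comp_apply, τ, LinearMap.sum_apply,
      LinearMap.lcomp_apply', this, TensorProduct.mk_apply, ← TensorProduct.smul_tmul,
      LinearMap.id_apply]
    rw [← TensorProduct.sum_tmul, b.sum_repr]
  have h2 : homEvaluation R X B E ∘ₗ τ = LinearMap.id := by
    ext ψ h
    simp only [LinearMap.comp_apply, τ, LinearMap.sum_apply, map_sum, TensorProduct.mk_apply,
      homEvaluation_tmul, LinearMap.lcomp_apply, LinearMap.id_apply]
    rw [← map_sum]
    congr 1
    refine b.ext fun i ↦ ?_
    simp [LinearMap.sum_apply, Finsupp.single_apply]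
  exact ⟨Function.LeftInverse.injective (LinearMap.congr_fun h1),
    Function.RightInverse.surjective (LinearMap.congr_fun h2)⟩

/-- Both sides are right exact in `X` (the right one because `E` is injective), so a finite
presentation reduces to the free case by a four-lemma chase. -/
lemma homEvaluation_injective [IsNoetherianRing R] [Module.Finite R X] [Module.Injective R E] :
    Function.Injective (homEvaluation R X B E) := by
  obtain ⟨F, _, _, _, _, p, hp⟩ := Module.exists_finite_presentation R X
  obtain ⟨F', _, _, _, _, p', hp'⟩ := Module.exists_finite_presentation R (LinearMap.ker p)
  let q : F' →ₗ[R] F := (LinearMap.ker p).subtype ∘ₗ p'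
  have hqp : Function.Exact q p := by
    rw [LinearMap.exact_iff, LinearMap.range_comp, LinearMap.range_eq_top.2 hp',
      Submodule.map_top, Submodule.range_subtype]
  have hpB : Function.Injective (p.lcomp R B) := LinearMap.lcomp_injective_of_surjective p hp
  have hex : Function.Exact ((q.lcomp R B).lcomp R E) ((p.lcomp R B).lcomp R E) := by
    intro ψ
    constructor
    · intro hψ
      have hle : LinearMap.ker (q.lcomp R B) ≤ LinearMap.ker ψ := fun h hh ↦ by
        obtain ⟨h', rfl⟩ := (LinearMap.exact_lcomp_of_exact_of_surjective B hqp hp h).1 hh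
        exact LinearMap.congr_fun hψ h'
      obtain ⟨ψ', hψ'⟩ := lcomp_surjective_of_injective (E := E)
        -- `ψ` descends to the quotient by the kernel of `q.lcomp R B`, which embeds in `Hom(F',
        -- B)`; injectivity of `E` extends it there.
        (f := (LinearMap.ker (q.lcomp R B)).liftQ (q.lcomp R B) le_rfl)
        (LinearMap.ker_eq_bot.1 (Submodule.ker_liftQ_eq_bot _ _ _ le_rfl))
        ((LinearMap.ker (q.lcomp R B)).liftQ ψ hle)
      refine ⟨ψ', ?_⟩
      ext h
      exact LinearMap.congr_fun hψ' (Submodule.Quotient.mk h)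
    · rintro ⟨ψ, rfl⟩
      ext h
      change ψ ((h ∘ₗ p) ∘ₗ q) = 0
      rw [LinearMap.comp_assoc, hqp.linearMap_comp_eq_zero, LinearMap.comp_zero, map_zero]
  exact LinearMap.injective_of_surjective_of_injective_of_right_exact _ _ _ _
    (homEvaluation R F' B E) (homEvaluation R F B E) (homEvaluation R X B E)
    (homEvaluation_naturality q) (homEvaluation_naturality p)
    (rTensor_exact (B →ₗ[R] E) hqp hp) hex homEvaluation_bijective_of_free.2
    homEvaluation_bijective_of_free.1 (LinearMap.rTensor_surjective _ hp)

/-- If `Ext^1(M, B) = 0`, then `Tor_1(M, Hom(B, E)) = 0` in the form of injectivity of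
`K ⊗ Hom(B, E) → F ⊗ Hom(B, E)`. -/
lemma rTensor_injective_of_extVanishes [IsNoetherianRing R] {K F M : Type u} [AddCommGroup K]
    [Module R K] [Module.Finite R K] [AddCommGroup F] [Module R F] [AddCommGroup M] [Module R M]
    [Module.Injective R E] {f : K →ₗ[R] F} {g : F →ₗ[R] M} (hf : Function.Injective f)
    (h : Function.Exact f g) (hg : Function.Surjective g) (hM : ExtVanishes R M B 1) :
    Function.Injective (f.rTensor (B →ₗ[R] E)) := by
  have hs : Function.Surjective (f.lcomp R B) := fun φ ↦ hM.exists_extension hf h hg φ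
  have hi : Function.Injective ((f.lcomp R B).lcomp R E) :=
    LinearMap.lcomp_injective_of_surjective _ hs
  have := hi.comp (homEvaluation_injective (R := R) (X := K) (B := B) (E := E))
  rw [← LinearMap.coe_comp, homEvaluation_naturality, LinearMap.coe_comp] at this
  exact this.of_comp

end HomEvaluation

/-! ### From Ext vanishing to Tor vanishing. -/

section TorShifting

open TensorProduct

variable {R : Type u} [CommRing R]

lemma lTensor_rTensor_apply {X Y A B : Type u} [AddCommGroup X] [Module R X] [AddCommGroup Y]
    [Module R Y] [AddCommGroup A] [Module R A] [AddCommGroup B] [Module R B]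
    (u : X →ₗ[R] Y) (v : A →ₗ[R] B) (t : X ⊗[R] A) :
    v.lTensor Y (u.rTensor A t) = u.rTensor B (v.lTensor X t) := by
  rw [← LinearMap.comp_apply, ← LinearMap.comp_apply, LinearMap.lTensor_comp_rTensor,
    LinearMap.rTensor_comp_lTensor]

/-- The diagram chase behind dimension shifting: `hK` says that an element over `K` which becomes a
boundary over `F` is already a boundary over `K`. -/
lemma lTensor_exact_of_exact {K F M P₀ P₁ P₂ : Type u} [AddCommGroup K] [Module R K]
    [AddCommGroup F] [Module R F] [AddCommGroup M] [Module R M] [AddCommGroup P₀] [Module R P₀]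
    [AddCommGroup P₁] [Module R P₁] [AddCommGroup P₂] [Module R P₂]
    {f : K →ₗ[R] F} {g : F →ₗ[R] M} (h : Function.Exact f g) (hg : Function.Surjective g)
    {d₂ : P₂ →ₗ[R] P₁} {d₁ : P₁ →ₗ[R] P₀} (hd : d₁ ∘ₗ d₂ = 0)
    (hF : Function.Exact (d₂.lTensor F) (d₁.lTensor F))
    (hK : ∀ (w : K ⊗[R] P₀) (z : F ⊗[R] P₁), f.rTensor P₀ w = d₁.lTensor F z →
      ∃ w', d₁.lTensor K w' = w) :
    Function.Exact (d₂.lTensor M) (d₁.lTensor M) := by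
  intro z
  constructor
  · intro hz
    obtain ⟨z', rfl⟩ := LinearMap.rTensor_surjective P₁ hg z
    rw [lTensor_rTensor_apply] at hz
    obtain ⟨w, hw⟩ := (rTensor_exact P₀ h hg _).1 hz
    obtain ⟨w', rfl⟩ := hK w z' hw
    rw [← lTensor_rTensor_apply] at hw
    obtain ⟨y, hy⟩ := (hF (z' - f.rTensor P₁ w')).1 (by rw [map_sub, hw, sub_self])
    refine ⟨g.rTensor P₂ y, ?_⟩
    rw [lTensor_rTensor_apply, hy, map_sub, (rTensor_exact P₁ h hg).apply_apply_eq_zero, sub_zero]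
  · rintro ⟨y, rfl⟩
    rw [← LinearMap.comp_apply, ← LinearMap.lTensor_comp, hd, LinearMap.lTensor_zero,
      LinearMap.zero_apply]

variable {N : Type u} [AddCommGroup N] [Module R N]
  (P : ProjectiveResolution (ModuleCat.of R N))

lemma CategoryTheory.ProjectiveResolution.moduleCat_exact_succ (i : ℕ) :
    Function.Exact (P.complex.d (i + 2) (i + 1)).hom (P.complex.d (i + 1) i).hom :=
  (ShortComplex.ShortExact.moduleCat_exact_iff_function_exact _).1 (P.exact_succ i)

lemma CategoryTheory.ProjectiveResolution.exists_moduleCat_augmentation :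
    ∃ ε : P.complex.X 0 →ₗ[R] N,
      Function.Exact (P.complex.d 1 0).hom ε ∧ Function.Surjective ε :=
  ⟨(P.π.f 0).hom, (ShortComplex.ShortExact.moduleCat_exact_iff_function_exact _).1 P.exact₀,
    (ModuleCat.epi_iff_surjective (P.π.f 0)).1 inferInstance⟩

instance (i : ℕ) : Module.Projective R (P.complex.X i) :=
  (IsProjective.iff_projective _).2 (P.projective i)

lemma torVanishes_of_exact {M : Type u} [AddCommGroup M] [Module R M] {i : ℕ}
    (h : Function.Exact ((P.complex.d (i + 2) (i + 1)).hom.lTensor M)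
      ((P.complex.d (i + 1) i).hom.lTensor M)) : TorVanishes R M N (i + 1) := by
  refine Limits.IsZero.of_iso ?_ (P.isoLeftDerivedObj _ (i + 1))
  refine (HomologicalComplex.exactAt_iff_isZero_homology _ _).1 ?_
  rw [HomologicalComplex.exactAt_iff' _ (i + 2) (i + 1) i (by simp) (by simp)]
  exact (ShortComplex.ShortExact.moduleCat_exact_iff_function_exact _).2 h

/-- Induction on degree through a syzygy of `M`. Degree one is injectivity of the syzygy inclusion
tensored with `B →ₗ[R] E`; higher degrees use flatness of the terms of `P`. -/
lemma lTensor_resolution_exact [IsNoetherianRing R] {B E : Type u} [AddCommGroup B] [Module R B]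
    [AddCommGroup E] [Module R E] [Module.Injective R E]
    (P : ProjectiveResolution (ModuleCat.of R (B →ₗ[R] E))) (i : ℕ) (M : Type u) [AddCommGroup M]
    [Module R M] [Module.Finite R M] (hM : ExtVanishes R M B (i + 1)) :
    Function.Exact ((P.complex.d (i + 2) (i + 1)).hom.lTensor M)
      ((P.complex.d (i + 1) i).hom.lTensor M) := by
  induction i generalizing M with
  | zero =>
    obtain ⟨F, _, _, _, _, p, hp⟩ := Module.exists_finite_presentation R M
    have hK := LinearMap.exact_subtype_ker_map p
    have hKi := (LinearMap.ker p).injective_subtype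
    refine lTensor_exact_of_exact hK hp (P.moduleCat_exact_succ 0).linearMap_comp_eq_zero
      (Module.Flat.lTensor_exact F (P.moduleCat_exact_succ 0)) fun w z hw ↦ ?_
    obtain ⟨ε, hε, hεs⟩ := P.exists_moduleCat_augmentation
    refine (lTensor_exact _ hε hεs w).1 (rTensor_injective_of_extVanishes hKi hK hp hM ?_)
    rw [map_zero, ← lTensor_rTensor_apply, hw, (lTensor_exact F hε hεs).apply_apply_eq_zero]
  | succ i ih =>
    obtain ⟨F, _, _, _, _, p, hp⟩ := Module.exists_finite_presentation R M
    have hK := LinearMap.exact_subtype_ker_map p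
    have hKi := (LinearMap.ker p).injective_subtype
    refine lTensor_exact_of_exact hK hp (P.moduleCat_exact_succ (i + 1)).linearMap_comp_eq_zero
      (Module.Flat.lTensor_exact F (P.moduleCat_exact_succ (i + 1))) fun w z hw ↦ ?_
    refine (ih _ (.of_exact_left hKi hK hp (.of_projective (by simp)) hM) w).1 ?_
    apply Module.Flat.rTensor_preserves_injective_linearMap (M := P.complex.X i) _ hKi
    rw [map_zero, ← lTensor_rTensor_apply, hw,
      (Module.Flat.lTensor_exact F (P.moduleCat_exact_succ i)).apply_apply_eq_zero]

/-- `Ext` vanishing into `B` implies `Tor` vanishing against `Hom(B, E)`. -/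
lemma ExtVanishes.torVanishes [IsNoetherianRing R] {B E M : Type u} [AddCommGroup B] [Module R B]
    [AddCommGroup E] [Module R E] [Module.Injective R E] [AddCommGroup M] [Module R M]
    [Module.Finite R M] {i : ℕ} (h : ExtVanishes R M B (i + 1)) :
    TorVanishes R M (B →ₗ[R] E) (i + 1) :=
  torVanishes_of_exact (projectiveResolution _) (lTensor_resolution_exact _ i M h)

end TorShifting

/-! ### Reduction modulo a regular sequence. -/

section RegularSequences

variable {R : Type u} [CommRing R]

open IsLocalRing RingTheory.Sequence Abelian Pointwise

/-- `Ext^i(M, B/rB)` sits between `Ext^i(M, B)` and `Ext^(i+1)(M, B)`, so the bound `n` survives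
every step. -/
lemma ExtVanishes.quotient_of_isWeaklyRegular {M : Type u} [AddCommGroup M] [Module R M] {n : ℕ}
    (rs : List R) (B : Type u) [AddCommGroup B] [Module R B] (hrs : IsWeaklyRegular B rs)
    (h : ∀ i, n ≤ i → ExtVanishes R M B i) (i : ℕ) (hi : n ≤ i) :
    ExtVanishes R M (B ⧸ (Ideal.ofList rs • ⊤ : Submodule R B)) i := by
  induction rs generalizing B with
  | nil =>
    exact (h i hi).congr_right (Submodule.quotEquivOfEqBot _ (by simp)).symm
  | cons r rs ih =>
    rw [isWeaklyRegular_cons_iff] at hrs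
    refine (ih (QuotSMulTop r B) hrs.2 fun j hj ↦ ?_).congr_right
      (Submodule.quotOfListConsSMulTopEquivQuotSMulTopInner B r rs).symm
    exact .of_exact_target (f := LinearMap.lsmul R B r) (g := (r • (⊤ : Submodule R B)).mkQ) hrs.1
      (LinearMap.exact_lsmul_mkQ_smul_top B r) (Submodule.mkQ_surjective _) (h j hj)
      (h (j + 1) (by lia))

/-- The injective dimension is detected by cyclic modules. -/
lemma hasInjectiveDimensionLT_of_extVanishes_quotient {n : ℕ} (B : Type u) [AddCommGroup B]
    [Module R B] (h : ∀ I : Ideal R, ExtVanishes R (R ⧸ I) B (n + 1)) :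
    HasInjectiveDimensionLT (ModuleCat.of R B) (n + 1) := by
  induction n generalizing B with
  | zero =>
    have hB : Module.Baer R B := fun I g ↦ by
      obtain ⟨ψ, hψ⟩ := (h I).exists_extension (f := I.subtype) (g := I.mkQ) I.injective_subtype
        (LinearMap.exact_subtype_mkQ I) I.mkQ_surjective g
      exact ⟨ψ, fun x hx ↦ LinearMap.congr_fun hψ ⟨x, hx⟩⟩
    have : Module.Injective R B := hB.injective
    have : Injective (ModuleCat.of R B) := Module.injective_object_of_injective_module R B
    infer_instance
  | succ n ih =>
    obtain ⟨⟨J, hJ, ι, hι⟩⟩ := EnoughInjectives.presentation (ModuleCat.of R B)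
    have hι : Function.Injective ι.hom := (ModuleCat.mono_iff_injective _).1 hι
    have hex := ι.hom.exact_map_mkQ_range
    have hs := Submodule.mkQ_surjective (LinearMap.range ι.hom)
    have hC := ih (J ⧸ LinearMap.range ι.hom) fun I ↦
      .of_exact_target hι hex hs (Ext.subsingleton_of_injective _ J n) (h I)
    exact ((moduleShortComplex_shortExact hι hex hs).hasInjectiveDimensionLT_X₃_iff n hJ).1 hC

variable [IsLocalRing R] [IsNoetherianRing R]

/-- The hypothesis makes multiplication by `x` surjective on the finitely generated module `Ext^i(N,
B)`, and Nakayama applies. -/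
lemma extVanishes_of_isSMulRegular {N B : Type u} [AddCommGroup N] [Module R N]
    [Module.Finite R N] [AddCommGroup B] [Module R B] [Module.Finite R B] {x : R}
    (hx : x ∈ maximalIdeal R) (hreg : IsSMulRegular B x) {i : ℕ}
    (h : ExtVanishes R N (QuotSMulTop x B) i) : ExtVanishes R N B i := by
  unfold ExtVanishes at *
  by_contra hne
  rw [not_subsingleton_iff_nontrivial] at hne
  have hmem : x ∈ (Module.annihilator R
      (Ext (ModuleCat.of R N) (ModuleCat.of R B) i)).jacobson := maximalIdeal_le_jacobson _ hx
  refine Submodule.top_ne_pointwise_smul_of_mem_jacobson_annihilator hmem ?_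
  symm
  rw [eq_top_iff]
  intro y _
  obtain ⟨z, hz⟩ := Ext.covariant_sequence_exact₂ (ModuleCat.of R N)
    (IsSMulRegular.smulShortComplex_shortExact (M := ModuleCat.of R B) hreg) y (h.elim _ _)
  have hcomp (t : Ext (ModuleCat.of R N) (ModuleCat.of R B) i) :
      t.comp (Ext.mk₀ (x • 𝟙 (ModuleCat.of R B))) (add_zero i) = x • t := by
    rw [Ext.mk₀_smul, Ext.comp_smul, Ext.comp_mk₀_id]
  have hz' : y = x • z := hz.symm.trans (hcomp z)
  rw [hz']
  exact Submodule.smul_mem_pointwise_smul _ _ ⊤ trivial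

lemma hasInjectiveDimensionLT_of_quotient_isWeaklyRegular {n : ℕ} (rs : List R)
    (hmem : ∀ r ∈ rs, r ∈ maximalIdeal R) (B : Type u) [AddCommGroup B] [Module R B]
    [Module.Finite R B] (hrs : IsWeaklyRegular B rs)
    (h : HasInjectiveDimensionLT
      (ModuleCat.of R (B ⧸ (Ideal.ofList rs • ⊤ : Submodule R B))) (n + 1)) :
    HasInjectiveDimensionLT (ModuleCat.of R B) (n + 1) := by
  induction rs generalizing B with
  | nil =>
    have h0 : (Ideal.ofList ([] : List R) • ⊤ : Submodule R B) = ⊥ := by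
      rw [Ideal.ofList_nil, Submodule.bot_smul]
    exact hasInjectiveDimensionLT_of_iso (Submodule.quotEquivOfEqBot _ h0).toModuleIso _
  | cons r rs ih =>
    rw [isWeaklyRegular_cons_iff] at hrs
    have hQ := ih (fun s hs ↦ hmem s (List.mem_cons_of_mem r hs)) (QuotSMulTop r B) hrs.2
      (hasInjectiveDimensionLT_of_iso
        (Submodule.quotOfListConsSMulTopEquivQuotSMulTopInner B r rs).toModuleIso _)
    exact hasInjectiveDimensionLT_of_extVanishes_quotient B fun I ↦
      extVanishes_of_isSMulRegular (hmem r List.mem_cons_self) hrs.1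
        (HasInjectiveDimensionLT.subsingleton _ (n + 1) (n + 1) le_rfl _)

omit [IsNoetherianRing R] in
/-- A Cohen-Macaulay local ring has a regular sequence of length the dimension. -/
lemma IsCohenMacaulayLocal.exists_isRegular (hR : IsCohenMacaulayLocal R) :
    ∃ rs : List R, IsRegular R rs ∧ (∀ r ∈ rs, r ∈ maximalIdeal R) ∧
      (rs.length : WithBot ℕ∞) = ringKrullDim R := by
  have := hR.isNoetherianRing
  -- Finiteness of the Krull dimension makes the supremum finite, hence attained.
  have hlt : localRingDepth R < ⊤ := by
    have h := ringKrullDim_lt_top (R := R)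
    rw [← hR.depth_eq_dim] at h
    exact WithBot.coe_lt_coe.1 h
  have heq : localRingDepth R = ⨆ rs : {rs : List R // IsRegular R rs ∧
      ∀ r ∈ rs, r ∈ maximalIdeal R}, (rs.1.length : ℕ∞) := by
    rw [localRingDepth, iSup_subtype']
  have : Nonempty {rs : List R // IsRegular R rs ∧ ∀ r ∈ rs, r ∈ maximalIdeal R} :=
    ⟨[], IsRegular.nil R R, by simp⟩
  rw [heq] at hlt
  obtain ⟨⟨rs, hrs, hmem⟩, h⟩ := ENat.exists_eq_iSup_of_lt_top hlt
  refine ⟨rs, hrs, hmem, ?_⟩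
  rw [← hR.depth_eq_dim, heq, ← h]
  rfl

/-- Each regular element lowers the dimension by one, so the quotient is Noetherian of dimension
zero, hence Artinian. -/
lemma isFiniteLength_quotient_of_isRegular {rs : List R} (hrs : IsRegular R rs)
    (hlen : (rs.length : WithBot ℕ∞) = ringKrullDim R) :
    IsFiniteLength R (R ⧸ (Ideal.ofList rs • ⊤ : Submodule R R)) := by
  have hdim := ringKrullDim_add_length_eq_ringKrullDim_of_isRegular rs hrs
  have h0 : ringKrullDim (R ⧸ Ideal.ofList rs) ≤ 0 := by
    rw [← hlen] at hdim
    have : ringKrullDim (R ⧸ Ideal.ofList rs) + rs.length ≤ 0 + rs.length := by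
      rw [hdim, zero_add]
    exact (ENat.WithBot.add_le_add_natCast_right_iff).1 this
  have : Ring.KrullDimLE 0 (R ⧸ Ideal.ofList rs) := by
    rw [Ring.krullDimLE_iff]; exact_mod_cast h0
  have : IsArtinianRing (R ⧸ Ideal.ofList rs) :=
    isArtinianRing_iff_isNoetherianRing_krullDimLE_zero.2 ⟨inferInstance, this⟩
  have hfin : Module.length R (R ⧸ Ideal.ofList rs) ≠ ⊤ := by
    rw [Module.length_eq_of_surjective (S := R) (R := R ⧸ Ideal.ofList rs)
      Ideal.Quotient.mk_surjective]
    exact Module.length_ne_top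
  rw [(Submodule.quotEquivOfEq (Ideal.ofList rs) (Ideal.ofList rs • ⊤ : Submodule R R)
    (by simp)).length_eq] at hfin
  exact Module.length_ne_top_iff.1 hfin

end RegularSequences

/-! ### The main theorem. -/

theorem mainTheorem8 (R : Type u) [CommRing R] [IsLocalRing R]
    (hR : IsCohenMacaulayLocal R)
    (M : Type u) [AddCommGroup M] [Module R M] [Module.Finite R M]
    (hM : IsGDimTestModule R M)
    (hExt : ∃ n : ℕ, ∀ i : ℕ, n ≤ i → ExtVanishes R M R i) :
    IsGorensteinLocal R := by
  have := hR.isNoetherianRing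
  obtain ⟨n, hn⟩ := hExt
  obtain ⟨rs, hrs, hmem, hlen⟩ := hR.exists_isRegular
  obtain ⟨E, _, _, e, _, he, hme, hsoc⟩ := exists_injective_simple_socle R
  let B := R ⧸ (Ideal.ofList rs • ⊤ : Submodule R R)
  have hB : IsFiniteLength R B := isFiniteLength_quotient_of_isRegular hrs hlen
  have hpd : HasProjectiveDimensionLT (ModuleCat.of R B) (rs.length + 1) := by
    rw [← projectiveDimension_lt_iff]
    have := ModuleCat.projectiveDimension_quotient_eq_add_length_of_isWeaklyRegular
      (ModuleCat.of R R) rs hrs.1 hmem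
    rw [ModuleCat.projectiveDimension_eq_zero_of_projective (ModuleCat.of R R), zero_add] at this
    exact this.trans_lt (by exact_mod_cast Nat.lt_succ_self _)
  have hid : HasInjectiveDimensionLT (ModuleCat.of R (B →ₗ[R] E)) (rs.length + 1) :=
    hasInjectiveDimensionLT_linearMap B hpd
  have hX : IsFiniteLength R (B →ₗ[R] E) := isFiniteLength_linearMap he hme hsoc hB
  have : IsNoetherian R (B →ₗ[R] E) := (isFiniteLength_iff_isNoetherian_isArtinian.1 hX).1
  -- The shift to `n + 1` only ensures a positive degree, as the passage from Ext to Tor requires.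
  obtain ⟨m, hm⟩ := hM (B →ₗ[R] E) ⟨n + 1, fun i hi ↦ by
    obtain ⟨i, rfl⟩ := Nat.exists_eq_succ_of_ne_zero (by lia : i ≠ 0)
    exact (ExtVanishes.quotient_of_isWeaklyRegular rs R hrs.1 hn (i + 1) (by lia)).torVanishes⟩
  obtain ⟨P, C, _, _, _, _, f, g, hP, hC, hf, hfg, hg⟩ := hm.exists_hull
  -- Extending the identity along `f` splits the hull sequence.
  obtain ⟨r, hr⟩ := (hC.extVanishes_of_hasInjectiveDimensionLT (X := B →ₗ[R] E)
    (n := rs.length + 1) one_pos).exists_extension hf hfg hg LinearMap.id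
  have hDP : HasInjectiveDimensionLT (ModuleCat.of R (P →ₗ[R] E)) (m + 1) :=
    hasInjectiveDimensionLT_linearMap P hP
  have hret : Retract (ModuleCat.of R ((B →ₗ[R] E) →ₗ[R] E)) (ModuleCat.of R (P →ₗ[R] E)) :=
    { i := ModuleCat.ofHom (r.lcomp R E)
      r := ModuleCat.ofHom (f.lcomp R E)
      retract := by
        ext1
        refine LinearMap.ext fun φ ↦ ?_
        change (φ ∘ₗ r) ∘ₗ f = φ
        rw [LinearMap.comp_assoc, hr, LinearMap.comp_id] }
  have hDD := hret.hasInjectiveDimensionLT (m + 1)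
  have hBid : HasInjectiveDimensionLT (ModuleCat.of R B) (m + 1) :=
    hasInjectiveDimensionLT_of_iso
      (LinearEquiv.ofBijective _ (bijective_applyₗ he hme hsoc hB)).symm.toModuleIso _
  have hRid : HasInjectiveDimensionLT (ModuleCat.of R R) (m + 1) :=
    hasInjectiveDimensionLT_of_quotient_isWeaklyRegular rs hmem R hrs.1 hBid
  exact ⟨hR.isNoetherianRing, (injectiveDimension_lt_iff.2 hRid).trans_le le_top⟩
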